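/- Let $\mathbb{C}$ be a Barr-exact category, i.e. a category with finite limits in which kernel pairs have coequalisers, regular epimorphisms are stable under pullback, and every equivalence relation is effective (is the kernel pair of some morphism). Call a morphism $f\colon A\to X$ of $\mathbb{C}$ coextensive if it satisfies the following two conditions. (C1) For every product diagram $A_1\leftarrow A\rightarrow A_2$ the pushouts of $f$ along both projections exist, and the resulting two pushout squares form a product diagram $X_1\leftarrow X\rightarrow X_2$. (C2) For every commutative diagram $$\begin{array}{ccccc}A_1&\leftarrow&A&\rightarrow&A_2\\ \downarrow&&\downarrow{\scriptstyle f}&&\downarrow\\ X_1&\leftarrow&X&\rightarrow&X_2\end{array}$$ in which both rows are product diagrams, both squares are pushouts. Call $\mathbb{C}$ coextensive if $\mathbb{C}^{\mathrm{op}}$ is an extensive category, i.e. $\mathbb{C}$ has finite products and pushouts along product projections, and in every commutative diagram as above (with any morphism $f$ in the middle) whose top row is a product diagram, the bottom row is a product diagram if and only if both squares are pushouts. Then every split monomorphism in $\mathbb{C}$ is coextensive if and only if $\mathbb{C}$ is coextensive; moreover, $\mathbb{C}$ is coextensive if and only if every morphism of $\mathbb{C}$ is coextensive. -/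

import Mathlib

open CategoryTheory CategoryTheory.Limits

universe v u

namespace Coext

section Morphisms

variable {C : Type u} [Category.{v} C]

/-- The span `A₁ ⟵ A ⟶ A₂` is a (binary) product diagram. -/
def IsProductDiagram {A A₁ A₂ : C} (p₁ : A ⟶ A₁) (p₂ : A ⟶ A₂) : Prop :=
  Nonempty (IsLimit (BinaryFan.mk p₁ p₂))

/-- Condition (C1) on `f : A ⟶ X`: for every product diagram `A₁ ⟵ A ⟶ A₂` the pushouts of `f`
along both projections exist, and any two such pushout squares form a product diagram
`X₁ ⟵ X ⟶ X₂`. -/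
def SatisfiesC1 {A X : C} (f : A ⟶ X) : Prop :=
  ∀ ⦃A₁ A₂ : C⦄ (p₁ : A ⟶ A₁) (p₂ : A ⟶ A₂), IsProductDiagram p₁ p₂ →
    HasPushout f p₁ ∧ HasPushout f p₂ ∧
      ∀ ⦃X₁ X₂ : C⦄ (x₁ : X ⟶ X₁) (x₂ : X ⟶ X₂) (f₁ : A₁ ⟶ X₁) (f₂ : A₂ ⟶ X₂),
        IsPushout f p₁ x₁ f₁ → IsPushout f p₂ x₂ f₂ → IsProductDiagram x₁ x₂

/-- Condition (C2) on `f : A ⟶ X`: in every commutative diagram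
```
A₁ ⟵ A ⟶ A₂
|     |f    |
v     v     v
X₁ ⟵ X ⟶ X₂
```
whose two rows are product diagrams, both squares are pushouts. -/
def SatisfiesC2 {A X : C} (f : A ⟶ X) : Prop :=
  ∀ ⦃A₁ A₂ X₁ X₂ : C⦄ (p₁ : A ⟶ A₁) (p₂ : A ⟶ A₂) (x₁ : X ⟶ X₁) (x₂ : X ⟶ X₂)
    (f₁ : A₁ ⟶ X₁) (f₂ : A₂ ⟶ X₂),
    f ≫ x₁ = p₁ ≫ f₁ → f ≫ x₂ = p₂ ≫ f₂ →
    IsProductDiagram p₁ p₂ → IsProductDiagram x₁ x₂ →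
      IsPushout f p₁ x₁ f₁ ∧ IsPushout f p₂ x₂ f₂

/-- A morphism is coextensive if it satisfies (C1) and (C2). -/
def IsCoextensiveMorphism {A X : C} (f : A ⟶ X) : Prop :=
  SatisfiesC1 f ∧ SatisfiesC2 f

end Morphisms

/-- A category is coextensive if its opposite is (finitary) extensive. -/
abbrev IsCoextensiveCategory (C : Type u) [Category.{v} C] : Prop :=
  FinitaryExtensive Cᵒᵖ

/-- A Barr-exact category: a regular category in which every (internal) equivalence relation is
effective, that is, the kernel pair of some morphism. -/
class BarrExact (C : Type u) [Category.{v} C] : Prop extends Regular C where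
  effective : ∀ {R X : C} (r₁ r₂ : R ⟶ X), IsEquivalenceRelation r₁ r₂ →
    ∃ (Y : C) (f : X ⟶ Y), IsKernelPair f r₁ r₂

end Coext

/-! Any `f : A ⟶ X` is its graph `A ⟶ A ⨯ X`, a split monomorphism, followed by a projection, and
coextensive morphisms compose; so projections suffice. (C2) at isomorphisms makes projections
regular epimorphisms (`isRegularEpi_fst`), so it remains to treat regular epimorphisms. For (C2),
the components of a regular epimorphism are regular epimorphisms, hence pushouts by
`isPushout_of_isRegularEpi`. For (C1), the diagonal into the kernel pair is a split monomorphism, so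
the kernel pair splits as a product of reflexive graphs. These are equivalence relations, and by
exactness their quotients give the product decomposition of `X`. -/

namespace Coext

/-! ### Product diagrams and composition of coextensive morphisms -/

section ProductDiagrams

variable {C : Type u} [Category.{v} C] {A A₁ A₂ X X₁ X₂ : C}

namespace IsProductDiagram

variable {p₁ : A ⟶ A₁} {p₂ : A ⟶ A₂}

theorem hom_ext (h : IsProductDiagram p₁ p₂) {T : C} {a b : T ⟶ A}
    (h₁ : a ≫ p₁ = b ≫ p₁) (h₂ : a ≫ p₂ = b ≫ p₂) : a = b :=
  BinaryFan.IsLimit.hom_ext h.some h₁ h₂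

theorem exists_lift (h : IsProductDiagram p₁ p₂) {T : C} (a : T ⟶ A₁) (b : T ⟶ A₂) :
    ∃ l : T ⟶ A, l ≫ p₁ = a ∧ l ≫ p₂ = b :=
  ⟨_, (BinaryFan.IsLimit.lift' h.some a b).2⟩

theorem of_exists_lift
    (hl : ∀ {T : C} (a : T ⟶ A₁) (b : T ⟶ A₂), ∃ l : T ⟶ A, l ≫ p₁ = a ∧ l ≫ p₂ = b)
    (he : ∀ {T : C} (a b : T ⟶ A), a ≫ p₁ = b ≫ p₁ → a ≫ p₂ = b ≫ p₂ → a = b) :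
    IsProductDiagram p₁ p₂ :=
  ⟨BinaryFan.isLimitMk (fun s => (hl s.fst s.snd).choose)
    (fun s => (hl s.fst s.snd).choose_spec.1) (fun s => (hl s.fst s.snd).choose_spec.2)
    (fun s _ h₁ h₂ => he _ _ (h₁.trans (hl s.fst s.snd).choose_spec.1.symm)
      (h₂.trans (hl s.fst s.snd).choose_spec.2.symm))⟩

theorem flip (h : IsProductDiagram p₁ p₂) : IsProductDiagram p₂ p₁ :=
  .of_exists_lift (fun a b => (h.exists_lift b a).imp fun _ hl => hl.symm)
    (fun _ _ h₁ h₂ => h.hom_ext h₂ h₁)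

theorem comp_iso (h : IsProductDiagram p₁ p₂) {B₁ B₂ : C} (e₁ : A₁ ≅ B₁) (e₂ : A₂ ≅ B₂) :
    IsProductDiagram (p₁ ≫ e₁.hom) (p₂ ≫ e₂.hom) :=
  .of_exists_lift
    (fun a b => (h.exists_lift (a ≫ e₁.inv) (b ≫ e₂.inv)).imp fun l hl => by
      simp [reassoc_of% hl.1, reassoc_of% hl.2])
    (fun a b h₁ h₂ => h.hom_ext
      (by simpa only [← Category.assoc, cancel_mono] using h₁)
      (by simpa only [← Category.assoc, cancel_mono] using h₂))

theorem iso_comp (h : IsProductDiagram p₁ p₂) (f : X ⟶ A) [IsIso f] :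
    IsProductDiagram (f ≫ p₁) (f ≫ p₂) :=
  .of_exists_lift
    (fun a b => by
      obtain ⟨l, h₁, h₂⟩ := h.exists_lift a b
      exact ⟨l ≫ inv f, by simp [h₁], by simp [h₂]⟩)
    (fun a b h₁ h₂ => by
      rw [← cancel_mono f]
      exact h.hom_ext (by simpa using h₁) (by simpa using h₂))

theorem prod (A₁ A₂ : C) [HasBinaryProduct A₁ A₂] :
    IsProductDiagram (prod.fst : A₁ ⨯ A₂ ⟶ A₁) prod.snd :=
  ⟨prodIsProd A₁ A₂⟩

end IsProductDiagram

/-- Condition (C1) may be checked on a single pair of pushout squares. -/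
theorem satisfiesC1_of_exists {f : A ⟶ X}
    (H : ∀ {A₁ A₂ : C} (p₁ : A ⟶ A₁) (p₂ : A ⟶ A₂), IsProductDiagram p₁ p₂ →
      ∃ (X₁ X₂ : C) (x₁ : X ⟶ X₁) (x₂ : X ⟶ X₂) (f₁ : A₁ ⟶ X₁) (f₂ : A₂ ⟶ X₂),
        IsPushout f p₁ x₁ f₁ ∧ IsPushout f p₂ x₂ f₂ ∧ IsProductDiagram x₁ x₂) :
    SatisfiesC1 f := by
  intro A₁ A₂ p₁ p₂ hp
  obtain ⟨X₁, X₂, x₁, x₂, f₁, f₂, h₁, h₂, hx⟩ := H p₁ p₂ hp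
  refine ⟨h₁.hasPushout, h₂.hasPushout, fun Y₁ Y₂ y₁ y₂ g₁ g₂ k₁ k₂ => ?_⟩
  have := hx.comp_iso (h₁.isoIsPushout _ _ k₁) (h₂.isoIsPushout _ _ k₂)
  simpa using this

theorem SatisfiesC1.exists_isPushout {f : A ⟶ X} (hf : SatisfiesC1 f) {p₁ : A ⟶ A₁} {p₂ : A ⟶ A₂}
    (hp : IsProductDiagram p₁ p₂) :
    ∃ (X₁ X₂ : C) (x₁ : X ⟶ X₁) (x₂ : X ⟶ X₂) (f₁ : A₁ ⟶ X₁) (f₂ : A₂ ⟶ X₂),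
      IsPushout f p₁ x₁ f₁ ∧ IsPushout f p₂ x₂ f₂ ∧ IsProductDiagram x₁ x₂ := by
  obtain ⟨_, _, h⟩ := hf p₁ p₂ hp
  exact ⟨_, _, _, _, _, _, .of_hasPushout f p₁, .of_hasPushout f p₂,
    h _ _ _ _ (.of_hasPushout f p₁) (.of_hasPushout f p₂)⟩

/-- Both conditions follow by pasting. For (C2), the middle row comes from (C1) for `f`, and (C2)
for `g` then applies below it. -/
theorem IsCoextensiveMorphism.comp {Y : C} {f : A ⟶ X} {g : X ⟶ Y}
    (hf : IsCoextensiveMorphism f) (hg : IsCoextensiveMorphism g) :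
    IsCoextensiveMorphism (f ≫ g) := by
  refine ⟨satisfiesC1_of_exists fun p₁ p₂ hp => ?_, ?_⟩
  · obtain ⟨X₁, X₂, x₁, x₂, f₁, f₂, h₁, h₂, hx⟩ := hf.1.exists_isPushout hp
    obtain ⟨Y₁, Y₂, y₁, y₂, g₁, g₂, k₁, k₂, hy⟩ := hg.1.exists_isPushout hx
    exact ⟨Y₁, Y₂, y₁, y₂, f₁ ≫ g₁, f₂ ≫ g₂, h₁.paste_horiz k₁, h₂.paste_horiz k₂, hy⟩
  · intro A₁ A₂ Y₁ Y₂ p₁ p₂ y₁ y₂ l₁ l₂ c₁ c₂ hp hy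
    obtain ⟨X₁, X₂, x₁, x₂, f₁, f₂, h₁, h₂, hx⟩ := hf.1.exists_isPushout hp
    obtain ⟨g₁, a₁, b₁⟩ : ∃ g₁ : X₁ ⟶ Y₁, x₁ ≫ g₁ = g ≫ y₁ ∧ f₁ ≫ g₁ = l₁ :=
      ⟨h₁.desc (g ≫ y₁) l₁ (by simpa using c₁), by simp, by simp⟩
    obtain ⟨g₂, a₂, b₂⟩ : ∃ g₂ : X₂ ⟶ Y₂, x₂ ≫ g₂ = g ≫ y₂ ∧ f₂ ≫ g₂ = l₂ :=
      ⟨h₂.desc (g ≫ y₂) l₂ (by simpa using c₂), by simp, by simp⟩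
    obtain ⟨k₁, k₂⟩ := hg.2 x₁ x₂ y₁ y₂ g₁ g₂ a₁.symm a₂.symm hx hy
    subst b₁ b₂
    exact ⟨h₁.paste_horiz k₁, h₂.paste_horiz k₂⟩

end ProductDiagrams

/-! ### Translation to extensivity of the opposite category -/

section CoextensiveCategory

variable {C : Type u} [Category.{v} C]

theorem nonempty_isColimit_iff_isProductDiagram {X Y : Cᵒᵖ} (c : BinaryCofan X Y) :
    Nonempty (IsColimit c) ↔ IsProductDiagram c.inl.unop c.inr.unop :=
  ⟨fun ⟨h⟩ => ⟨BinaryCofan.IsColimit.unop h⟩,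
    fun ⟨h⟩ => ⟨(BinaryFan.IsLimit.op h).ofIsoColimit (isoBinaryCofanMk c).symm⟩⟩

theorem isCoextensiveCategory_of_forall [HasFiniteProducts C]
    (H : ∀ ⦃A X : C⦄ (f : A ⟶ X), IsCoextensiveMorphism f) : IsCoextensiveCategory C := by
  have (X Y Z : Cᵒᵖ) (f : Z ⟶ X ⨿ Y) : HasPullback (coprod.inl : X ⟶ X ⨿ Y) f := by
    have hp := (nonempty_isColimit_iff_isProductDiagram _).1 ⟨coprodIsCoprod X Y⟩
    have : HasPushout f.unop (coprod.inl : X ⟶ X ⨿ Y).unop := ((H f.unop).1 _ _ hp).1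
    exact (IsPushout.of_hasPushout f.unop (coprod.inl : X ⟶ X ⨿ Y).unop).op.hasPullback
  have : HasPullbacksOfInclusions Cᵒᵖ := { }
  refine ⟨fun c hc => (BinaryCofan.isVanKampen_iff c).2 fun c' α₁ α₂ f h₁ h₂ => ?_⟩
  have hp := (nonempty_isColimit_iff_isProductDiagram _).1 ⟨hc⟩
  rw [nonempty_isColimit_iff_isProductDiagram]
  constructor
  · intro hx
    obtain ⟨k₁, k₂⟩ := (H f.unop).2 _ _ _ _ α₁.unop α₂.unop
      (congrArg Quiver.Hom.unop h₁.symm) (congrArg Quiver.Hom.unop h₂.symm) hp hx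
    exact ⟨k₁.op.flip, k₂.op.flip⟩
  · rintro ⟨k₁, k₂⟩
    exact ((H f.unop).1 _ _ hp).2.2 _ _ _ _ k₁.flip.unop k₂.flip.unop

theorem IsCoextensiveCategory.isCoextensiveMorphism [IsCoextensiveCategory C] {A X : C}
    (f : A ⟶ X) : IsCoextensiveMorphism f := by
  have key : ∀ {A₁ A₂ X₁ X₂ : C} (p₁ : A ⟶ A₁) (p₂ : A ⟶ A₂) (x₁ : X ⟶ X₁) (x₂ : X ⟶ X₂)
      (f₁ : A₁ ⟶ X₁) (f₂ : A₂ ⟶ X₂), f ≫ x₁ = p₁ ≫ f₁ → f ≫ x₂ = p₂ ≫ f₂ →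
      IsProductDiagram p₁ p₂ →
        (IsProductDiagram x₁ x₂ ↔ IsPushout f p₁ x₁ f₁ ∧ IsPushout f p₂ x₂ f₂) := by
    intro A₁ A₂ X₁ X₂ p₁ p₂ x₁ x₂ f₁ f₂ h₁ h₂ hp
    have hc := (nonempty_isColimit_iff_isProductDiagram (BinaryCofan.mk p₁.op p₂.op)).2 hp
    have := (BinaryCofan.isVanKampen_iff _).1 (FinitaryExtensive.vanKampen _ hc.some)
      (BinaryCofan.mk x₁.op x₂.op) f₁.op f₂.op f.op
      (congrArg Quiver.Hom.op h₁.symm) (congrArg Quiver.Hom.op h₂.symm)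
    rw [nonempty_isColimit_iff_isProductDiagram] at this
    exact this.trans ⟨fun k => ⟨k.1.flip.unop, k.2.flip.unop⟩, fun k => ⟨k.1.op.flip, k.2.op.flip⟩⟩
  refine ⟨satisfiesC1_of_exists fun {A₁ A₂} p₁ p₂ hp => ?_, ?_⟩
  · have hc := (nonempty_isColimit_iff_isProductDiagram (BinaryCofan.mk p₁.op p₂.op)).2 hp
    have h₁ : HasPullback f.op p₁.op :=
      FinitaryPreExtensive.hasPullbacks_of_is_coproduct hc.some ⟨.left⟩ f.op
    have h₂ : HasPullback f.op p₂.op :=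
      FinitaryPreExtensive.hasPullbacks_of_is_coproduct hc.some ⟨.right⟩ f.op
    have k₁ : IsPushout f p₁ _ _ := (IsPullback.of_hasPullback f.op p₁.op).flip.unop
    have k₂ : IsPushout f p₂ _ _ := (IsPullback.of_hasPullback f.op p₂.op).flip.unop
    exact ⟨_, _, _, _, _, _, k₁, k₂, (key p₁ p₂ _ _ _ _ k₁.w k₂.w hp).2 ⟨k₁, k₂⟩⟩
  · intro A₁ A₂ X₁ X₂ p₁ p₂ x₁ x₂ f₁ f₂ h₁ h₂ hp hx
    exact (key p₁ p₂ x₁ x₂ f₁ f₂ h₁ h₂ hp).1 hx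

end CoextensiveCategory

/-! ### Regular epimorphisms and product projections -/

section Regular

variable {C : Type u} [Category.{v} C] {A A₁ A₂ X X₁ X₂ : C} {p₁ : A ⟶ A₁} {p₂ : A ⟶ A₂}
  {x₁ : X ⟶ X₁} {x₂ : X ⟶ X₂}

theorem isIso_of_isIso_prod (H : ∀ ⦃A X : C⦄ (f : A ⟶ X), IsIso f → SatisfiesC2 f)
    (hp : IsProductDiagram p₁ p₂) (hx : IsProductDiagram x₁ x₂) {f : A ⟶ X} [IsIso f]
    {f₁ : A₁ ⟶ X₁} {f₂ : A₂ ⟶ X₂} (h₁ : f ≫ x₁ = p₁ ≫ f₁) (h₂ : f ≫ x₂ = p₂ ≫ f₂) : IsIso f₁ :=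
  (H f inferInstance p₁ p₂ x₁ x₂ f₁ f₂ h₁ h₂ hp hx).1.isIso_inr_of_isIso

/-- If `p₁` factors through a monomorphism `m : I ⟶ A₁`, then `A` is also a product of `I` and `A₂`,
so (C2) at `𝟙 A` forces `m` to be invertible. Thus `p₁` is extremal, hence regular. -/
theorem isRegularEpi_fst [Regular C] (H : ∀ ⦃A X : C⦄ (f : A ⟶ X), IsIso f → SatisfiesC2 f)
    (hp : IsProductDiagram p₁ p₂) : IsRegularEpi p₁ := by
  have : ExtremalEpi p₁ := ExtremalEpi.mk_of_hasEqualizers _ fun I g m hgm _ => by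
    have hI : IsProductDiagram g p₂ := by
      refine .of_exists_lift (fun a b => ?_) (fun a b h₁ h₂ => hp.hom_ext ?_ h₂)
      · obtain ⟨l, h₁, h₂⟩ := hp.exists_lift (a ≫ m) b
        exact ⟨l, by rw [← cancel_mono m, Category.assoc, hgm, h₁], h₂⟩
      · rw [← hgm, reassoc_of% h₁]
    exact isIso_of_isIso_prod H hI hp (f := 𝟙 A) (f₂ := 𝟙 A₂) (by simp [hgm]) (by simp)
  infer_instance

/-- A pair of maps into the ends of a jointly monic span factors through it as soon as it does so
after precomposition with a regular epimorphism. -/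
theorem exists_factor_of_isRegularEpi {R Y Z P W : C} {r : R ⟶ Y} {s : R ⟶ Z}
    (hrs : ∀ {T : C} (a b : T ⟶ R), a ≫ r = b ≫ r → a ≫ s = b ≫ s → a = b)
    (e : P ⟶ W) [IsRegularEpi e] (x : P ⟶ R) {a : W ⟶ Y} {b : W ⟶ Z}
    (ha : x ≫ r = e ≫ a) (hb : x ≫ s = e ≫ b) : ∃ y : W ⟶ R, y ≫ r = a ∧ y ≫ s = b := by
  obtain ⟨y, hy⟩ : ∃ y : W ⟶ R, e ≫ y = x :=
    ⟨IsRegularEpi.desc e x (hrs _ _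
      (by simp [ha, reassoc_of% (IsRegularEpi.w e)])
      (by simp [hb, reassoc_of% (IsRegularEpi.w e)])), IsRegularEpi.fac _ _ _⟩
  exact ⟨y, by rw [← cancel_epi e, reassoc_of% hy, ha], by rw [← cancel_epi e, reassoc_of% hy, hb]⟩

/-- If product projections are epimorphisms and `f` is an epimorphism which is the product of a
regular epimorphism `f₁` and a morphism `f₂`, then `f₁` is the pushout of `f` along the first
projection. -/
theorem isPushout_of_isRegularEpi [HasBinaryProducts C]
    (he : ∀ {A A₁ A₂ : C} {p₁ : A ⟶ A₁} {p₂ : A ⟶ A₂}, IsProductDiagram p₁ p₂ → Epi p₁)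
    (hp : IsProductDiagram p₁ p₂) (hx : IsProductDiagram x₁ x₂)
    {f : A ⟶ X} {f₁ : A₁ ⟶ X₁} {f₂ : A₂ ⟶ X₂} [Epi f] [IsRegularEpi f₁]
    (h₁ : f ≫ x₁ = p₁ ≫ f₁) (h₂ : f ≫ x₂ = p₂ ≫ f₂) : IsPushout f p₁ x₁ f₁ := by
  have desc : ∀ {T : C} (s : X ⟶ T) (t : A₁ ⟶ T), f ≫ s = p₁ ≫ t → ∃ w : X₁ ⟶ T, f₁ ≫ w = t := by
    intro T s t hst
    refine ⟨IsRegularEpi.desc f₁ t ?_, IsRegularEpi.fac _ _ _⟩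
    have hπ := he (IsProductDiagram.prod (IsRegularEpi.W f₁) A₂)
    -- The pair coequalised by `f₁`, multiplied by `A₂`, gives two maps into `A` that `f`
    -- identifies; the epic projection from `W ⨯ A₂` is then cancelled.
    obtain ⟨k, hk₁, hk₂⟩ := hp.exists_lift
      (prod.fst ≫ IsRegularEpi.left f₁) (prod.snd : IsRegularEpi.W f₁ ⨯ A₂ ⟶ A₂)
    obtain ⟨l, hl₁, hl₂⟩ := hp.exists_lift
      (prod.fst ≫ IsRegularEpi.right f₁) (prod.snd : IsRegularEpi.W f₁ ⨯ A₂ ⟶ A₂)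
    have hkl : k ≫ f = l ≫ f := hx.hom_ext
      (by simp [h₁, reassoc_of% hk₁, reassoc_of% hl₁, IsRegularEpi.w f₁])
      (by simp [h₂, reassoc_of% hk₂, reassoc_of% hl₂])
    rw [← cancel_epi (prod.fst : IsRegularEpi.W f₁ ⨯ A₂ ⟶ _), ← reassoc_of% hk₁,
      ← reassoc_of% hl₁, ← hst, reassoc_of% hkl]
  refine ⟨⟨h₁⟩, ⟨PushoutCocone.IsColimit.mk _ (fun s => (desc s.inl s.inr s.condition).choose)
    (fun s => ?_) (fun s => (desc s.inl s.inr s.condition).choose_spec) fun s m _ hm => ?_⟩⟩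
  · rw [← cancel_epi f, reassoc_of% h₁, (desc s.inl s.inr s.condition).choose_spec, s.condition]
  · rw [← cancel_epi f₁, hm, (desc s.inl s.inr s.condition).choose_spec]

theorem satisfiesC2_of_isRegularEpi [Regular C]
    (hr : ∀ {A A₁ A₂ : C} {p₁ : A ⟶ A₁} {p₂ : A ⟶ A₂}, IsProductDiagram p₁ p₂ → IsRegularEpi p₁)
    (f : A ⟶ X) [IsRegularEpi f] : SatisfiesC2 f := by
  have key : ∀ {A₁ A₂ X₁ X₂ : C} {p₁ : A ⟶ A₁} {p₂ : A ⟶ A₂} {x₁ : X ⟶ X₁} {x₂ : X ⟶ X₂}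
      {f₁ : A₁ ⟶ X₁} {f₂ : A₂ ⟶ X₂}, f ≫ x₁ = p₁ ≫ f₁ → f ≫ x₂ = p₂ ≫ f₂ →
      IsProductDiagram p₁ p₂ → IsProductDiagram x₁ x₂ → IsPushout f p₁ x₁ f₁ := by
    intro A₁ A₂ X₁ X₂ p₁ p₂ x₁ x₂ f₁ f₂ h₁ h₂ hp hx
    have := hr hx
    have : StrongEpi (p₁ ≫ f₁) := h₁ ▸ strongEpi_comp f x₁
    have : StrongEpi f₁ := strongEpi_of_strongEpi p₁ f₁
    exact isPushout_of_isRegularEpi (fun h => have := hr h; inferInstance) hp hx h₁ h₂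
  intro A₁ A₂ X₁ X₂ p₁ p₂ x₁ x₂ f₁ f₂ h₁ h₂ hp hx
  exact ⟨key h₁ h₂ hp hx, key h₂ h₁ hp.flip hx.flip⟩

/-- If an equivalence relation is a product of two reflexive graphs, then the first graph is an
equivalence relation, provided that product projections are regular epimorphisms. -/
theorem isEquivalenceRelation_fst [HasFiniteLimits C]
    (hr : ∀ {A A₁ A₂ : C} {p₁ : A ⟶ A₁} {p₂ : A ⟶ A₂}, IsProductDiagram p₁ p₂ → IsRegularEpi p₁)
    {R R₁ R₂ : C} {r s : R ⟶ A} {r₁ s₁ : R₁ ⟶ A₁} {r₂ s₂ : R₂ ⟶ A₂} {d₁ : A₁ ⟶ R₁} {d₂ : A₂ ⟶ R₂}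
    {ρ₁ : R ⟶ R₁} {ρ₂ : R ⟶ R₂} (h : IsEquivalenceRelation r s)
    (hp : IsProductDiagram p₁ p₂) (hρ : IsProductDiagram ρ₁ ρ₂)
    (hr₁ : r ≫ p₁ = ρ₁ ≫ r₁) (hr₂ : r ≫ p₂ = ρ₂ ≫ r₂)
    (hs₁ : s ≫ p₁ = ρ₁ ≫ s₁) (hs₂ : s ≫ p₂ = ρ₂ ≫ s₂)
    (hdr₁ : d₁ ≫ r₁ = 𝟙 _) (hds₁ : d₁ ≫ s₁ = 𝟙 _)
    (hdr₂ : d₂ ≫ r₂ = 𝟙 _) (hds₂ : d₂ ≫ s₂ = 𝟙 _) : IsEquivalenceRelation r₁ s₁ := by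
  obtain ⟨⟨E⟩⟩ := h
  have mono : ∀ {T : C} (a b : T ⟶ R₁), a ≫ r₁ = b ≫ r₁ → a ≫ s₁ = b ≫ s₁ → a = b := by
    intro T a b har has
    -- Generalised elements of `R₁` are lifted to `R` over the regular epic cover `T ⨯ R₂`.
    have := hr (IsProductDiagram.prod T R₂)
    obtain ⟨u, hu₁, hu₂⟩ := hρ.exists_lift (prod.fst ≫ a) (prod.snd : T ⨯ R₂ ⟶ R₂)
    obtain ⟨v, hv₁, hv₂⟩ := hρ.exists_lift (prod.fst ≫ b) (prod.snd : T ⨯ R₂ ⟶ R₂)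
    have huv : u = v := E.right_cancellation _ _
      (hp.hom_ext (by simp [hr₁, reassoc_of% hu₁, reassoc_of% hv₁, har])
        (by simp [hr₂, reassoc_of% hu₂, reassoc_of% hv₂]))
      (hp.hom_ext (by simp [hs₁, reassoc_of% hu₁, reassoc_of% hv₁, has])
        (by simp [hs₂, reassoc_of% hu₂, reassoc_of% hv₂]))
    rw [← cancel_epi (prod.fst : T ⨯ R₂ ⟶ T), ← hu₁, ← hv₁, huv]
  -- Padding by the reflexivity `d₂` gives both ends the same second coordinate, so composable pairs
  -- in `R₁` remain composable in `R`.
  have ext : ∀ {W : C} (a : W ⟶ R₁), ∃ u : W ⨯ A₂ ⟶ R, u ≫ ρ₁ = prod.fst ≫ a ∧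
      u ≫ r ≫ p₂ = prod.snd ∧ u ≫ s ≫ p₂ = prod.snd := by
    intro W a
    obtain ⟨u, hu₁, hu₂⟩ := hρ.exists_lift (prod.fst ≫ a) ((prod.snd : W ⨯ A₂ ⟶ A₂) ≫ d₂)
    exact ⟨u, hu₁, by simp [hr₂, reassoc_of% hu₂, hdr₂], by simp [hs₂, reassoc_of% hu₂, hds₂]⟩
  obtain ⟨σ, hσr, hσs⟩ : ∃ σ : R₁ ⟶ R₁, σ ≫ r₁ = s₁ ∧ σ ≫ s₁ = r₁ := by
    have := hr hρ
    exact exists_factor_of_isRegularEpi mono ρ₁ (E.s ≫ ρ₁)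
      (by rw [Category.assoc, ← hr₁, E.symmetry₁_assoc, hs₁])
      (by rw [Category.assoc, ← hs₁, E.symmetry₂_assoc, hr₁])
  obtain ⟨τ, hτr, hτs⟩ : ∃ τ : pullback s₁ r₁ ⟶ R₁,
      τ ≫ r₁ = pullback.fst s₁ r₁ ≫ r₁ ∧ τ ≫ s₁ = pullback.snd s₁ r₁ ≫ s₁ := by
    have := hr (IsProductDiagram.prod (pullback s₁ r₁) A₂)
    obtain ⟨u, hu, -, hus⟩ := ext (pullback.fst s₁ r₁)
    obtain ⟨v, hv, hvr, -⟩ := ext (pullback.snd s₁ r₁)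
    obtain ⟨w, hwu, hwv⟩ := PullbackCone.IsLimit.lift' E.isLimit u v
      (hp.hom_ext (by simp [hr₁, hs₁, reassoc_of% hu, reassoc_of% hv, pullback.condition])
        (by simp [hus, hvr]))
    exact exists_factor_of_isRegularEpi mono (prod.fst : pullback s₁ r₁ ⨯ A₂ ⟶ _) (w ≫ E.t ≫ ρ₁)
      (by simp only [Category.assoc, ← hr₁, E.transitivity₁_assoc, reassoc_of% hwu]
          rw [hr₁, reassoc_of% hu])
      (by simp only [Category.assoc, ← hs₁, E.transitivity₂_assoc, reassoc_of% hwv]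
          rw [hs₁, reassoc_of% hv])
  exact EquivalenceRelation.isEquivalenceRelation
    { right_cancellation := fun _ a b => mono a b
      r := d₁
      reflexivity₁ := hdr₁
      reflexivity₂ := hds₁
      s := σ
      symmetry₁ := hσr
      symmetry₂ := hσs
      c := _
      isLimit := pullbackIsPullback s₁ r₁
      t := τ
      transitivity₁ := hτr
      transitivity₂ := hτs }

/-- The product of two regular epimorphisms is a strong epimorphism. -/
theorem strongEpi_of_isProductDiagram [Regular C] (hp : IsProductDiagram p₁ p₂)
    (hx : IsProductDiagram x₁ x₂) {f : A ⟶ X} {f₁ : A₁ ⟶ X₁} {f₂ : A₂ ⟶ X₂}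
    [IsRegularEpi f₁] [IsRegularEpi f₂] (h₁ : f ≫ x₁ = p₁ ≫ f₁) (h₂ : f ≫ x₂ = p₂ ≫ f₂) :
    StrongEpi f := by
  have hm := IsProductDiagram.prod X₁ A₂
  obtain ⟨g, hg₁, hg₂⟩ := hm.exists_lift (p₁ ≫ f₁) p₂
  obtain ⟨k, hk₁, hk₂⟩ := hx.exists_lift (prod.fst : X₁ ⨯ A₂ ⟶ X₁) (prod.snd ≫ f₂)
  have hgk : g ≫ k = f := hx.hom_ext (by simp [hk₁, hg₁, h₁]) (by simp [hk₂, reassoc_of% hg₂, h₂])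
  -- `f` is `f₁ × 1` followed by `1 × f₂`, base changes of `f₁` and `f₂` respectively.
  have sq₁ : IsPullback p₁ g f₁ prod.fst := by
    refine ⟨⟨hg₁.symm⟩, ⟨PullbackCone.IsLimit.mk _
      (fun s => (hp.exists_lift s.fst (s.snd ≫ prod.snd)).choose)
      (fun s => (hp.exists_lift s.fst (s.snd ≫ prod.snd)).choose_spec.1)
      (fun s => hm.hom_ext ?_ ?_) (fun s m h₁ h₂ => hp.hom_ext ?_ ?_)⟩⟩
    all_goals obtain ⟨ha, hb⟩ := (hp.exists_lift s.fst (s.snd ≫ prod.snd)).choose_spec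
    · rw [Category.assoc, hg₁, reassoc_of% ha, s.condition]
    · rw [Category.assoc, hg₂, hb]
    · rw [ha, h₁]
    · rw [hb, ← h₂, Category.assoc, hg₂]
  have sq₂ : IsPullback prod.snd k f₂ x₂ := by
    refine ⟨⟨hk₂.symm⟩, ⟨PullbackCone.IsLimit.mk _
      (fun s => (hm.exists_lift (s.snd ≫ x₁) s.fst).choose)
      (fun s => (hm.exists_lift (s.snd ≫ x₁) s.fst).choose_spec.2)
      (fun s => hx.hom_ext ?_ ?_) (fun s m h₁ h₂ => hm.hom_ext ?_ ?_)⟩⟩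
    all_goals obtain ⟨ha, hb⟩ := (hm.exists_lift (s.snd ≫ x₁) s.fst).choose_spec
    · rw [Category.assoc, hk₁, ha]
    · rw [Category.assoc, hk₂, reassoc_of% hb, s.condition]
    · rw [ha, ← h₂, Category.assoc, hk₁]
    · rw [hb, h₁]
  have i₁ : IsRegularEpi g := Regular.regularEpiIsStableUnderBaseChange.of_isPullback sq₁
    (show IsRegularEpi f₁ from inferInstance)
  have i₂ : IsRegularEpi k := Regular.regularEpiIsStableUnderBaseChange.of_isPullback sq₂
    (show IsRegularEpi f₂ from inferInstance)
  exact hgk ▸ strongEpi_comp g k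

end Regular

/-! ### Quotients by split kernel pairs and the reduction to split monomorphisms -/

section BarrExact

variable {C : Type u} [Category.{v} C] [BarrExact C]

theorem exists_isRegularEpi_isKernelPair {R X : C} (r s : R ⟶ X) (h : IsEquivalenceRelation r s) :
    ∃ (Y : C) (q : X ⟶ Y), IsRegularEpi q ∧ IsKernelPair q r s := by
  obtain ⟨Y, f, hf⟩ := BarrExact.effective r s h
  have := Regular.hasCoequalizer_of_isKernelPair hf
  refine ⟨_, coequalizer.π r s, inferInstance, ?_⟩
  exact IsKernelPair.cancel_right (f₂ := coequalizer.desc f hf.w) (coequalizer.condition r s)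
    (by simpa using hf)

theorem satisfiesC1_of_isRegularEpi
    (H : ∀ ⦃A X : C⦄ (f : A ⟶ X), IsSplitMono f → SatisfiesC1 f)
    (hr : ∀ {A A₁ A₂ : C} {p₁ : A ⟶ A₁} {p₂ : A ⟶ A₂}, IsProductDiagram p₁ p₂ → IsRegularEpi p₁)
    {A X : C} (f : A ⟶ X) [IsRegularEpi f] : SatisfiesC1 f := by
  refine satisfiesC1_of_exists fun {A₁ A₂} p₁ p₂ hp => ?_
  have hk := IsKernelPair.of_hasPullback f
  set R := pullback f f
  set r : R ⟶ A := pullback.fst f f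
  set s : R ⟶ A := pullback.snd f f
  obtain ⟨d, hdr, hds⟩ : ∃ d : A ⟶ R, d ≫ r = 𝟙 A ∧ d ≫ s = 𝟙 A :=
    ⟨hk.lift (𝟙 A) (𝟙 A) rfl, hk.lift_fst _ _ _, hk.lift_snd _ _ _⟩
  obtain ⟨R₁, R₂, ρ₁, ρ₂, d₁, d₂, po₁, po₂, hρ⟩ :=
    (H d ⟨⟨⟨r, hdr⟩⟩⟩).exists_isPushout hp
  obtain ⟨r₁, hr₁, hdr₁⟩ : ∃ r₁ : R₁ ⟶ A₁, ρ₁ ≫ r₁ = r ≫ p₁ ∧ d₁ ≫ r₁ = 𝟙 _ :=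
    ⟨po₁.desc (r ≫ p₁) (𝟙 _) (by simp [reassoc_of% hdr]), by simp, by simp⟩
  obtain ⟨s₁, hs₁, hds₁⟩ : ∃ s₁ : R₁ ⟶ A₁, ρ₁ ≫ s₁ = s ≫ p₁ ∧ d₁ ≫ s₁ = 𝟙 _ :=
    ⟨po₁.desc (s ≫ p₁) (𝟙 _) (by simp [reassoc_of% hds]), by simp, by simp⟩
  obtain ⟨r₂, hr₂, hdr₂⟩ : ∃ r₂ : R₂ ⟶ A₂, ρ₂ ≫ r₂ = r ≫ p₂ ∧ d₂ ≫ r₂ = 𝟙 _ :=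
    ⟨po₂.desc (r ≫ p₂) (𝟙 _) (by simp [reassoc_of% hdr]), by simp, by simp⟩
  obtain ⟨s₂, hs₂, hds₂⟩ : ∃ s₂ : R₂ ⟶ A₂, ρ₂ ≫ s₂ = s ≫ p₂ ∧ d₂ ≫ s₂ = 𝟙 _ :=
    ⟨po₂.desc (s ≫ p₂) (𝟙 _) (by simp [reassoc_of% hds]), by simp, by simp⟩
  have hE : IsEquivalenceRelation r s :=
    (hk.equivalenceRelation f r s (pullbackIsPullback s r)).isEquivalenceRelation
  obtain ⟨X₁, q₁, _, k₁⟩ := exists_isRegularEpi_isKernelPair r₁ s₁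
    (isEquivalenceRelation_fst hr hE hp hρ hr₁.symm hr₂.symm hs₁.symm hs₂.symm
      hdr₁ hds₁ hdr₂ hds₂)
  obtain ⟨X₂, q₂, _, k₂⟩ := exists_isRegularEpi_isKernelPair r₂ s₂
    (isEquivalenceRelation_fst hr hE hp.flip hρ.flip hr₂.symm hr₁.symm hs₂.symm hs₁.symm
      hdr₂ hds₂ hdr₁ hds₁)
  obtain ⟨x₁, hx₁⟩ := IsRegularEpi.exists_of_isKernelPair f hk (p₁ ≫ q₁)
    (by rw [← reassoc_of% hr₁, ← reassoc_of% hs₁, k₁.w])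
  obtain ⟨x₂, hx₂⟩ := IsRegularEpi.exists_of_isKernelPair f hk (p₂ ≫ q₂)
    (by rw [← reassoc_of% hr₂, ← reassoc_of% hs₂, k₂.w])
  have hP := IsProductDiagram.prod X₁ X₂
  obtain ⟨x, hxx₁, hxx₂⟩ := hP.exists_lift x₁ x₂
  -- Maps identified by both quotients give elements of `R₁` and `R₂`, hence of their product `R`.
  -- So `f ≫ x` has the same kernel pair as `f`, and `x` is invertible because both are regular
  -- epimorphisms.
  have hmono : ∀ {T : C} (a b : T ⟶ A), a ≫ p₁ ≫ q₁ = b ≫ p₁ ≫ q₁ →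
      a ≫ p₂ ≫ q₂ = b ≫ p₂ ≫ q₂ → a ≫ f = b ≫ f := by
    intro T a b h₁ h₂
    obtain ⟨w, hw₁, hw₂⟩ := hρ.exists_lift
      (k₁.lift (a ≫ p₁) (b ≫ p₁) (by simpa using h₁)) (k₂.lift (a ≫ p₂) (b ≫ p₂) (by simpa using h₂))
    have ha : w ≫ r = a := hp.hom_ext
      (by rw [Category.assoc, ← hr₁, reassoc_of% hw₁, k₁.lift_fst])
      (by rw [Category.assoc, ← hr₂, reassoc_of% hw₂, k₂.lift_fst])
    have hb : w ≫ s = b := hp.hom_ext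
      (by rw [Category.assoc, ← hs₁, reassoc_of% hw₁, k₁.lift_snd])
      (by rw [Category.assoc, ← hs₂, reassoc_of% hw₂, k₂.lift_snd])
    rw [← ha, ← hb, Category.assoc, Category.assoc, hk.w]
  have : StrongEpi (f ≫ x) := strongEpi_of_isProductDiagram hp hP
    (f₁ := q₁) (f₂ := q₂) (by simp [hxx₁, hx₁]) (by simp [hxx₂, hx₂])
  have : IsKernelPair (f ≫ x) r s :=
    ⟨⟨by simp only [← Category.assoc, hk.w]⟩, ⟨PullbackCone.IsLimit.mk _
      (fun t => hk.lift t.fst t.snd (hmono _ _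
        (by simpa [hxx₁, hx₁] using t.condition =≫ prod.fst)
        (by simpa [hxx₂, hx₂] using t.condition =≫ prod.snd)))
      (fun t => hk.lift_fst _ _ _) (fun t => hk.lift_snd _ _ _)
      (fun t m h₁ h₂ => hk.hom_ext (by simp [h₁]) (by simp [h₂]))⟩⟩
  have hiso : IsIso x := by
    obtain ⟨g, hg⟩ := IsRegularEpi.exists_of_isKernelPair (f ≫ x) this f hk.w
    rw [Category.assoc] at hg
    refine ⟨g, by rw [← cancel_epi f, hg, Category.comp_id], ?_⟩
    rw [← cancel_epi (f ≫ x), Category.assoc, reassoc_of% hg, Category.comp_id]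
  have hx : IsProductDiagram x₁ x₂ := by
    simpa only [hxx₁, hxx₂] using hP.iso_comp x
  have he : ∀ {A A₁ A₂ : C} {p₁ : A ⟶ A₁} {p₂ : A ⟶ A₂}, IsProductDiagram p₁ p₂ → Epi p₁ :=
    fun h => have := hr h; inferInstance
  exact ⟨X₁, X₂, x₁, x₂, q₁, q₂, isPushout_of_isRegularEpi he hp hx hx₁ hx₂,
    isPushout_of_isRegularEpi he hp.flip hx.flip hx₂ hx₁, hx⟩

theorem isCoextensiveMorphism_of_isSplitMono
    (H : ∀ ⦃A X : C⦄ (f : A ⟶ X), IsSplitMono f → IsCoextensiveMorphism f)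
    ⦃A X : C⦄ (f : A ⟶ X) : IsCoextensiveMorphism f := by
  have hr : ∀ {A A₁ A₂ : C} {p₁ : A ⟶ A₁} {p₂ : A ⟶ A₂}, IsProductDiagram p₁ p₂ →
      IsRegularEpi p₁ :=
    isRegularEpi_fst fun A X f _ => (H f inferInstance).2
  have : IsRegularEpi (prod.snd : A ⨯ X ⟶ X) := hr (IsProductDiagram.prod A X).flip
  obtain ⟨g, hg₁, hg₂⟩ := (IsProductDiagram.prod A X).exists_lift (𝟙 A) f
  have := (H g ⟨⟨⟨prod.fst, hg₁⟩⟩⟩).comp (g := prod.snd)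
    ⟨satisfiesC1_of_isRegularEpi (fun A X f hf => (H f hf).1) hr _,
      satisfiesC2_of_isRegularEpi hr _⟩
  rwa [hg₂] at this

end BarrExact

end Coext

theorem mainTheorem1 {C : Type u} [Category.{v} C] [Coext.BarrExact C] :
    ((∀ ⦃A X : C⦄ (f : A ⟶ X), IsSplitMono f → Coext.IsCoextensiveMorphism f) ↔
      Coext.IsCoextensiveCategory C) ∧
    (Coext.IsCoextensiveCategory C ↔
      ∀ ⦃A X : C⦄ (f : A ⟶ X), Coext.IsCoextensiveMorphism f) := by
  have h₁ (H : ∀ ⦃A X : C⦄ (f : A ⟶ X), IsSplitMono f → Coext.IsCoextensiveMorphism f) :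
      ∀ ⦃A X : C⦄ (f : A ⟶ X), Coext.IsCoextensiveMorphism f :=
    Coext.isCoextensiveMorphism_of_isSplitMono H
  have h₂ : Coext.IsCoextensiveCategory C ↔
      ∀ ⦃A X : C⦄ (f : A ⟶ X), Coext.IsCoextensiveMorphism f :=
    ⟨fun _ _ _ f => Coext.IsCoextensiveCategory.isCoextensiveMorphism f,
      Coext.isCoextensiveCategory_of_forall⟩
  exact ⟨⟨fun H => h₂.2 (h₁ H), fun H _ _ f _ => h₂.1 H f⟩, h₂⟩
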